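/- Let $G$ be a finitely generated group whose abelianisation $G^{\mathrm{ab}}$ is free abelian. For a class $a\in H^2(G,\mathbb{Z})$ (trivial coefficients) let $f_a\colon H_2(G,\mathbb{Z})\to\mathbb{Z}$ be the Kronecker map of $a$, i.e. the homomorphism induced by evaluating 2-cocycles on 2-cycles. Call $a$ *rich* if $f_a$ is surjective, and *weakly bounded* if it lies in the kernel of the natural map $H^2(G,\mathbb{Z})\to H^2_\infty(G,\mathbb{Z})=H^2(G,\ell^\infty(G,\mathbb{Z}))$ to $\ell^\infty$-cohomology, which is induced by the inclusion of $\mathbb{Z}$ as the constant functions in the $G$-module $\ell^\infty(G,\mathbb{Z})$ of bounded functions $G\to\mathbb{Z}$. Call two classes $a,b$ *distinguished* if $\ker f_a\neq\ker f_b$. Let $S\subseteq H^2(G,\mathbb{Z})$ be an uncountable set of pairwise distinguished classes, each of which is both rich and weakly bounded. For each $a\in S$ let $1\to\mathbb{Z}\to E_a\to G\to 1$ be a central extension corresponding to $a$ (such an extension always exists; any choice is allowed). Then all the groups $E_a$ ($a\in S$) are finitely generated and quasi-isometric to each other and to $G\times\mathbb{Z}$, and there is an uncountable subset $T\subseteq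 S$ such that $E_a\not\cong E_b$ for all distinct $a,b\in T$. Here finitely generated groups are quasi-isometric if their Cayley graphs for finite generating sets are. -/

import Mathlib

namespace LargeQIClass

/-! ### Quasi-isometries -/

/-- `f` is a quasi-isometry of metric spaces: a quasi-isometric embedding which is a coarse
surjection. -/
structure IsQuasiIsometry {X Y : Type*} [MetricSpace X] [MetricSpace Y] (f : X → Y) : Prop where
  embedding : ∃ C K : ℝ, 1 ≤ C ∧ 0 ≤ K ∧ ∀ a b : X,
    1 / C * dist a b - K ≤ dist (f a) (f b) ∧ dist (f a) (f b) ≤ C * dist a b + K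
  coarselySurjective : ∃ ε : ℝ, 0 ≤ ε ∧ ∀ y : Y, ∃ x : X, dist (f x) y ≤ ε

/-- The Cayley graph of a group with respect to a generating set is connected. -/
theorem mulCayley_connected {G : Type*} [Group G] {S : Set G} (hS : Subgroup.closure S = ⊤) :
    (SimpleGraph.mulCayley S).Connected := by
  have h1 : ∀ g : G, (SimpleGraph.mulCayley S).Reachable 1 g := by
    intro g
    have hg : g ∈ Subgroup.closure S := by rw [hS]; trivial
    have step : ∀ x s : G, s ∈ S → (SimpleGraph.mulCayley S).Reachable x (x * s) := by
      intro x s hs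
      by_cases h : x = x * s
      · rw [← h]
      · exact SimpleGraph.Adj.reachable
          ((SimpleGraph.mulCayley_adj' S _ _).2 ⟨h, s, hs, Or.inl rfl⟩)
    induction hg using Subgroup.closure_induction_right with
    | one => exact SimpleGraph.Reachable.refl _
    | mul_right x hx s hs ih => exact ih.trans (step x s hs)
    | mul_inv_cancel x hx s hs ih =>
      refine ih.trans (SimpleGraph.Reachable.symm ?_)
      simpa using step (x * s⁻¹) s hs
  exact (SimpleGraph.connected_iff _).2 ⟨fun a b => (h1 a).symm.trans (h1 b), ⟨1⟩⟩

/-- The word metric on a group `G` with respect to a generating set `S`: the path metric on the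
vertices of the Cayley graph. -/
noncomputable abbrev wordMetric {G : Type*} [Group G] (S : Set G)
    (hS : Subgroup.closure S = ⊤) : MetricSpace G where
  dist g h := ((SimpleGraph.mulCayley S).dist g h : ℝ)
  dist_self g := by simp
  dist_comm g h := by rw [SimpleGraph.dist_comm]
  dist_triangle g h k := by exact_mod_cast (mulCayley_connected hS).dist_triangle
  eq_of_dist_eq_zero {g h} hgh := by
    have h0 : (SimpleGraph.mulCayley S).dist g h = 0 := by exact_mod_cast hgh
    exact (mulCayley_connected hS).dist_eq_zero_iff.1 h0

/-- Two groups are quasi-isometric if both are finitely generated and they are quasi-isometric for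
the word metrics of finite generating sets (it does not matter which ones). -/
def QuasiIsometricGroups (G H : Type*) [Group G] [Group H] : Prop :=
  ∃ (S : Set G) (T : Set H) (hS : Subgroup.closure S = ⊤) (hT : Subgroup.closure T = ⊤),
    S.Finite ∧ T.Finite ∧
      ∃ f : G → H, @IsQuasiIsometry G H (wordMetric S hS) (wordMetric T hT) f

/-! ### The Kronecker pairing in degree two -/

variable (G : Type) [Group G]

/-- `ℤ` with the trivial action of `G`. -/
noncomputable abbrev trivialZ : Rep.{0} ℤ G := Rep.trivial ℤ G ℤ

/-- `H²(G, ℤ)`. -/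
noncomputable abbrev Cohomology2 : Type := groupCohomology.H2 (trivialZ G)

/-- The Schur multiplier `H₂(G, ℤ)`. -/
noncomputable abbrev Homology2 : Type := groupHomology.H2 (trivialZ G)

/-- Evaluation of inhomogeneous 2-cochains on inhomogeneous 2-chains. -/
noncomputable def evalChain (G : Type) : (G × G → ℤ) →ₗ[ℤ] (G × G →₀ ℤ) →ₗ[ℤ] ℤ where
  toFun f := Finsupp.linearCombination ℤ f
  map_add' f g := by ext; simp
  map_smul' r f := by ext; simp

theorem evalChain_apply {G : Type} (f : G × G → ℤ) (c : G × G →₀ ℤ) :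
    evalChain G f c = c.sum fun x n => n * f x := by
  simp [evalChain, Finsupp.linearCombination_apply]

variable {G}

/-- A cocycle vanishes on boundaries. -/
theorem evalChain_boundary (f : groupCohomology.cocycles₂ (trivialZ G)) (c : G × G →₀ ℤ)
    (hc : c ∈ groupHomology.boundaries₂ (trivialZ G)) : evalChain G f.1 c = 0 := by
  obtain ⟨y, rfl⟩ := hc
  have hf := (groupCohomology.mem_cocycles₂_iff f.1).1 f.2
  induction y using Finsupp.induction_linear with
  | zero => simp
  | add y z hy hz => rw [map_add, map_add, hy, hz, add_zero]
  | single g a =>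
    have h := hf g.1 g.2.1 g.2.2
    have key : (f.1 (g.1 * g.2.1, g.2.2) : ℤ) + f.1 (g.1, g.2.1)
        = f.1 (g.2.1, g.2.2) + f.1 (g.1, g.2.1 * g.2.2) := h
    have e : (ModuleCat.Hom.hom (groupHomology.d₃₂ (trivialZ G))) (Finsupp.single g a)
        = (Finsupp.single (g.2.1, g.2.2) a - Finsupp.single (g.1 * g.2.1, g.2.2) a +
      Finsupp.single (g.1, g.2.1 * g.2.2) a - Finsupp.single (g.1, g.2.1) a : G × G →₀ ℤ) :=
      groupHomology.d₃₂_single (A := trivialZ G) g a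
    rw [e]
    simp only [map_sub, map_add, evalChain, LinearMap.coe_mk, AddHom.coe_mk,
      Finsupp.linearCombination_single, smul_eq_mul]
    linear_combination -(a : ℤ) * key

/-- A coboundary vanishes on cycles. -/
theorem evalChain_cycle (f : G × G → ℤ) (hf : f ∈ groupCohomology.coboundaries₂ (trivialZ G))
    (c : groupHomology.cycles₂ (trivialZ G)) : evalChain G f c.1 = 0 := by
  obtain ⟨x, rfl⟩ := hf
  have hc : groupHomology.d₂₁ (trivialZ G) c.1 = 0 := c.2
  let x' : G → ℤ := x
  have key : ∀ c : G × G →₀ ℤ, evalChain G (groupCohomology.d₁₂ (trivialZ G) x) c =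
      Finsupp.linearCombination ℤ x' (groupHomology.d₂₁ (trivialZ G) c) := by
    intro c
    induction c using Finsupp.induction_linear with
    | zero => simp
    | add y z hy hz => rw [map_add, map_add, hy, hz]; exact (map_add _ _ _).symm
    | single g a =>
      have e : groupHomology.d₂₁ (trivialZ G) (Finsupp.single g a) =
          (Finsupp.single g.2 a - Finsupp.single (g.1 * g.2) a + Finsupp.single g.1 a
            : G →₀ ℤ) := groupHomology.d₂₁_single (A := trivialZ G) g a
      have e' : (groupCohomology.d₁₂ (trivialZ G) x) g = (x' g.2 - x' (g.1 * g.2) + x' g.1) := rfl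
      rw [e]
      simp only [map_sub, map_add, evalChain, LinearMap.coe_mk, AddHom.coe_mk,
        Finsupp.linearCombination_single, smul_eq_mul]
      rw [e']
      ring
  refine (key c.1).trans ?_
  rw [hc]
  exact map_zero _

theorem descend_le {R M N P : Type*} [CommRing R] [AddCommGroup M] [AddCommGroup N]
    [AddCommGroup P] [Module R M] [Module R N] [Module R P] (p : M →ₗ[R] N) (f : M →ₗ[R] P)
    (hf : ∀ m, p m = 0 → f m = 0) : LinearMap.ker p ≤ LinearMap.ker f :=
  fun m hm => LinearMap.mem_ker.2 (hf m (LinearMap.mem_ker.1 hm))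

/-- Descent of a linear map along a surjection. -/
noncomputable def descend {R M N P : Type*} [CommRing R] [AddCommGroup M] [AddCommGroup N]
    [AddCommGroup P] [Module R M] [Module R N] [Module R P]
    (p : M →ₗ[R] N) (hp : Function.Surjective p) (f : M →ₗ[R] P)
    (hf : ∀ m, p m = 0 → f m = 0) : N →ₗ[R] P :=
  (LinearMap.ker p).liftQ f (descend_le p f hf) ∘ₗ
    (p.quotKerEquivOfSurjective hp).symm.toLinearMap

theorem descend_apply {R M N P : Type*} [CommRing R] [AddCommGroup M] [AddCommGroup N]
    [AddCommGroup P] [Module R M] [Module R N] [Module R P]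
    (p : M →ₗ[R] N) (hp : Function.Surjective p) (f : M →ₗ[R] P)
    (hf : ∀ m, p m = 0 → f m = 0) (m : M) : descend p hp f hf (p m) = f m := by
  have : (p.quotKerEquivOfSurjective hp).symm (p m) = (LinearMap.ker p).mkQ m := by
    rw [LinearEquiv.symm_apply_eq]; rfl
  rw [descend, LinearMap.comp_apply, LinearEquiv.coe_coe, this, Submodule.mkQ_apply,
    Submodule.liftQ_apply]

variable (G)

/-- The projection from 2-cocycles to `H²(G, ℤ)`. -/
noncomputable abbrev cocycleClass :
    groupCohomology.cocycles₂ (trivialZ G) →ₗ[ℤ] Cohomology2 G :=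
  (groupCohomology.H2π (trivialZ G)).hom

/-- The projection from 2-cycles to `H₂(G, ℤ)`. -/
noncomputable abbrev cycleClass :
    groupHomology.cycles₂ (trivialZ G) →ₗ[ℤ] Homology2 G :=
  (groupHomology.H2π (trivialZ G)).hom

theorem cocycleClass_surjective : Function.Surjective (cocycleClass G) :=
  (ModuleCat.epi_iff_surjective _).1 inferInstance

theorem cycleClass_surjective : Function.Surjective (cycleClass G) :=
  (ModuleCat.epi_iff_surjective _).1 inferInstance

/-- Evaluation of 2-cocycles on 2-cycles. -/
noncomputable def evalCycle : groupCohomology.cocycles₂ (trivialZ G) →ₗ[ℤ]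
    groupHomology.cycles₂ (trivialZ G) →ₗ[ℤ] ℤ where
  toFun f :=
    { toFun := fun c => evalChain G f.1 c.1
      map_add' := fun c d => map_add (evalChain G f.1) c.1 d.1
      map_smul' := fun r c => map_smul (evalChain G f.1) r c.1 }
  map_add' f g := LinearMap.ext fun c => congrArg (fun F => F c.1) (map_add (evalChain G) f.1 g.1)
  map_smul' r f := LinearMap.ext fun c => congrArg (fun F => F c.1) (map_smul (evalChain G) r f.1)

variable {G}

theorem evalCycle_eq_zero (f : groupCohomology.cocycles₂ (trivialZ G))
    (c : groupHomology.cycles₂ (trivialZ G)) (hc : cycleClass G c = 0) :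
    evalCycle G f c = 0 :=
  evalChain_boundary f c.1 ((groupHomology.H2π_eq_zero_iff c).1 hc)

theorem evalCycle_eq_zero' (f : groupCohomology.cocycles₂ (trivialZ G))
    (hf : cocycleClass G f = 0) (c : groupHomology.cycles₂ (trivialZ G)) :
    evalCycle G f c = 0 :=
  evalChain_cycle f.1 ((groupCohomology.H2π_eq_zero_iff f).1 hf) c

variable (G)

/-- The homomorphism `H₂(G, ℤ) → ℤ` given by evaluation of a 2-cocycle. -/
noncomputable def evalHomology :
    groupCohomology.cocycles₂ (trivialZ G) →ₗ[ℤ] (Homology2 G →ₗ[ℤ] ℤ) where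
  toFun f := descend (cycleClass G) (cycleClass_surjective G) (evalCycle G f)
    (evalCycle_eq_zero f)
  map_add' f g := by
    refine LinearMap.ext fun c => ?_
    obtain ⟨c, rfl⟩ := cycleClass_surjective G c
    rw [LinearMap.add_apply, descend_apply, descend_apply, descend_apply, map_add,
      LinearMap.add_apply]
  map_smul' r f := by
    refine LinearMap.ext fun c => ?_
    obtain ⟨c, rfl⟩ := cycleClass_surjective G c
    rw [LinearMap.smul_apply, descend_apply, descend_apply, map_smul, LinearMap.smul_apply,
      RingHom.id_apply]

variable {G}

theorem evalHomology_apply (f : groupCohomology.cocycles₂ (trivialZ G))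
    (c : groupHomology.cycles₂ (trivialZ G)) :
    evalHomology G f (cycleClass G c) = evalCycle G f c :=
  descend_apply (cycleClass G) (cycleClass_surjective G) (evalCycle G f) (evalCycle_eq_zero f) c

theorem evalHomology_eq_zero (f : groupCohomology.cocycles₂ (trivialZ G))
    (hf : cocycleClass G f = 0) : evalHomology G f = 0 := by
  refine LinearMap.ext fun c => ?_
  obtain ⟨c, rfl⟩ := cycleClass_surjective G c
  rw [evalHomology_apply, evalCycle_eq_zero' f hf, LinearMap.zero_apply]

variable (G)

/-- The Kronecker map `H²(G, ℤ) → Hom(H₂(G, ℤ), ℤ)`, induced by evaluation of 2-cochains on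
2-chains; see `kronecker_apply`. -/
noncomputable def kronecker : Cohomology2 G →ₗ[ℤ] (Homology2 G →ₗ[ℤ] ℤ) :=
  descend (cocycleClass G) (cocycleClass_surjective G) (evalHomology G) evalHomology_eq_zero

variable {G}

theorem kronecker_apply (f : groupCohomology.cocycles₂ (trivialZ G))
    (c : groupHomology.cycles₂ (trivialZ G)) :
    kronecker G (cocycleClass G f) (cycleClass G c) =
      (c.1 : G × G →₀ ℤ).sum fun x n => n * (f.1 x : ℤ) := by
  rw [kronecker, descend_apply, evalHomology_apply]
  exact evalChain_apply f.1 c.1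

/-- A class is rich if its Kronecker map `H₂(G, ℤ) → ℤ` is surjective. -/
def IsRich (a : Cohomology2 G) : Prop := Function.Surjective (kronecker G a)

/-- Two classes are distinguished if their Kronecker maps have different kernels. -/
def AreDistinguished (a b : Cohomology2 G) : Prop :=
  LinearMap.ker (kronecker G a) ≠ LinearMap.ker (kronecker G b)

/-! ### `ℓ^∞`-cohomology -/

variable (G)

/-- The module `ℓ^∞(G, ℤ)` of bounded functions `G → ℤ`. -/
def boundedFunctions : Submodule ℤ (G → ℤ) where
  carrier := {f | ∃ C : ℤ, ∀ x, |f x| ≤ C}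
  zero_mem' := ⟨0, fun x => by simp⟩
  add_mem' := by
    rintro f g ⟨C, hC⟩ ⟨D, hD⟩
    exact ⟨C + D, fun x => (abs_add_le _ _).trans (add_le_add (hC x) (hD x))⟩
  smul_mem' := by
    rintro r f ⟨C, hC⟩
    refine ⟨|r| * C, fun x => ?_⟩
    simpa [abs_mul] using mul_le_mul_of_nonneg_left (hC x) (abs_nonneg r)

/-- The left translation action of `G` on `ℓ^∞(G, ℤ)`: `(g • f) x = f (g⁻¹ * x)`. -/
def boundedFunctionsRep : Representation ℤ G (boundedFunctions G) where
  toFun g :=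
    { toFun := fun f => ⟨fun x => f.1 (g⁻¹ * x), by
        obtain ⟨C, hC⟩ := f.2
        exact ⟨C, fun x => hC _⟩⟩
      map_add' := fun _ _ => rfl
      map_smul' := fun _ _ => rfl }
  map_one' := by ext f x; simp
  map_mul' g h := by ext f x; simp [mul_assoc]

/-- `ℓ^∞(G, ℤ)` as a `G`-module. -/
noncomputable abbrev ellInfty : Rep.{0} ℤ G := Rep.of (boundedFunctionsRep G)

/-- The inclusion of `ℤ` in `ℓ^∞(G, ℤ)` as the constant functions. -/
noncomputable def constants : trivialZ G ⟶ ellInfty G :=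
  Rep.ofHom
    { toFun := fun n => (⟨fun _ => n, |n|, fun _ => le_rfl⟩ : boundedFunctions G)
      map_add' := fun _ _ => rfl
      map_smul' := fun _ _ => rfl
      isIntertwining' := fun _ => rfl }

/-- The natural map `H²(G, ℤ) → H²_∞(G, ℤ) = H²(G, ℓ^∞(G, ℤ))` to `ℓ^∞`-cohomology. -/
noncomputable def toEllInftyCohomology :
    Cohomology2 G →ₗ[ℤ] groupCohomology.H2 (ellInfty G) :=
  (groupCohomology.map (MonoidHom.id G) (constants G) 2).hom

variable {G}

/-- A class is weakly bounded if it lies in the kernel of the map to `ℓ^∞`-cohomology. -/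
def IsWeaklyBounded (a : Cohomology2 G) : Prop := toEllInftyCohomology G a = 0

/-! ### Central extensions -/

/-- The extension `1 → ℤ → E → G → 1` is central and corresponds to the class `a ∈ H²(G, ℤ)`:
for a set-theoretic section `σ` of `E → G`, the 2-cocycle `f` determined by
`σ g * σ h = f (g, h) * σ (g * h)` represents `a`. -/
structure IsCentralExtensionOfClass {E : Type*} [Group E]
    (X : GroupExtension (Multiplicative ℤ) E G) (a : Cohomology2 G) : Prop where
  central : X.inl.range ≤ Subgroup.center E
  class_eq : ∃ (σ : X.Section) (f : groupCohomology.cocycles₂ (trivialZ G)),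
    (∀ g h : G, σ g * σ h = X.inl (Multiplicative.ofAdd (f (g, h) : ℤ)) * σ (g * h)) ∧
      cocycleClass G f = a

end LargeQIClass

/-! Quasi-isometry. If `f` represents a weakly bounded class, then `f`, read as a cocycle of
constant functions, is the coboundary of some `φ : G → ℓ^∞(G, ℤ)`. Evaluating at the point 1 and
correcting the section by `φ g 1` turns the cocycle into `φ h (g⁻¹) - φ h 1`, which for fixed `h` is
bounded in `g` (`exists_section_bounded`). In the coordinates `(g, n) ↦ n · σ g`, right
multiplication by a fixed element of `E` then differs from that in `G × ℤ` by finitely many central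
elements. So the coordinate bijection and its inverse are Lipschitz for word metrics
(`exists_equiv_prod`, `quasiIsometricGroups_of_equiv`); finite generation passes along it too.

Non-isomorphism is a counting argument. Inside one finitely generated group `E`, a central extension
of `G` by `ℤ` is determined up to equivalence by the image of 1 in `E` and the projection `E → G`.
As `E` and `G` are countable and `E` is finitely generated, there are countably many such pairs, and
equivalent extensions have the same class (`countable_of_mulEquiv`). Isomorphism therefore splits
`S` into countable blocks, and `T` takes one class from each. -/

namespace LargeQIClass

/-! ### Maps of finite displacement and quasi-isometries -/

/-- A map between groups has finite displacement if moving the argument by a fixed group element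
on the right moves the value by one of finitely many group elements. -/
def HasFiniteDisplacement {G H : Type*} [Group G] [Group H] (f : G → H) : Prop :=
  ∀ s : G, (Set.range fun x => (f x)⁻¹ * f (x * s)).Finite

theorem HasFiniteDisplacement.comp {G H K : Type*} [Group G] [Group H] [Group K]
    {f : H → K} {g : G → H} (hf : HasFiniteDisplacement f) (hg : HasFiniteDisplacement g) :
    HasFiniteDisplacement (f ∘ g) := by
  intro s
  refine ((hg s).biUnion fun t _ => hf t).subset ?_
  rintro _ ⟨x, rfl⟩
  refine Set.mem_biUnion ⟨x, rfl⟩ ⟨g x, ?_⟩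
  simp

/-- Finite generation passes along surjections of finite displacement. -/
theorem HasFiniteDisplacement.fg {G H : Type*} [Group G] [Group H] [Group.FG G] {f : G → H}
    (hf : HasFiniteDisplacement f) (hsurj : Function.Surjective f) : Group.FG H := by
  obtain ⟨S, hS, hfin⟩ := Group.fg_iff.1 (inferInstance : Group.FG G)
  -- `f 1` is included because `f` need not preserve the identity, and the induction along words
  -- starts there.
  set U : Set H := insert (f 1) (⋃ s ∈ S, Set.range fun x => (f x)⁻¹ * f (x * s)) with hU
  have hUfin : U.Finite := (hfin.biUnion fun s _ => hf s).insert _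
  have hmem : ∀ x, ∀ s ∈ S, (f x)⁻¹ * f (x * s) ∈ Subgroup.closure U := fun x s hs =>
    Subgroup.subset_closure (Set.mem_insert_of_mem _ (Set.mem_biUnion hs ⟨x, rfl⟩))
  refine Group.fg_iff.2 ⟨U, (Subgroup.eq_top_iff' _).2 fun h => ?_, hUfin⟩
  obtain ⟨x, rfl⟩ := hsurj h
  have hx : x ∈ Subgroup.closure S := hS ▸ Subgroup.mem_top x
  induction hx using Subgroup.closure_induction_right with
  | one => exact Subgroup.subset_closure (Set.mem_insert _ _)
  | mul_right x _ s hs ih => simpa using mul_mem ih (hmem x s hs)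
  | mul_inv_cancel x _ s hs ih =>
    have h := mul_mem ih (inv_mem (hmem (x * s⁻¹) s hs))
    simpa using h

/-- Edges are right multiplications by generators, so left multiplication is a graph homomorphism.
This lets a displacement `(f x)⁻¹ * f (x * s)` be measured from 1, uniformly in `x`. -/
theorem dist_mulCayley_mul_left_le {G : Type*} [Group G] {S : Set G}
    (hS : Subgroup.closure S = ⊤) (g x y : G) :
    (SimpleGraph.mulCayley S).dist (g * x) (g * y) ≤ (SimpleGraph.mulCayley S).dist x y := by
  obtain ⟨p, hp⟩ := (mulCayley_connected hS).exists_walk_length_eq_dist x y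
  let φ : SimpleGraph.mulCayley S →g SimpleGraph.mulCayley S :=
    { toFun := fun z => g * z
      map_rel' := by
        intro a b hab
        rw [SimpleGraph.mulCayley_adj'] at hab ⊢
        simpa [mul_assoc] using hab }
  rw [← hp, ← SimpleGraph.Walk.length_map φ p]
  exact SimpleGraph.dist_le _

theorem dist_le_mul_dist {V W : Type*} {Γ : SimpleGraph V} {Δ : SimpleGraph W}
    (hΓ : Γ.Connected) (hΔ : Δ.Connected) (f : V → W) (C : ℕ)
    (h : ∀ x y, Γ.Adj x y → Δ.dist (f x) (f y) ≤ C) (x y : V) :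
    Δ.dist (f x) (f y) ≤ C * Γ.dist x y := by
  obtain ⟨p, hp⟩ := hΓ.exists_walk_length_eq_dist x y
  rw [← hp]
  clear hp
  induction p with
  | nil => simp
  | cons hadj p ih =>
    rw [SimpleGraph.Walk.length_cons, mul_add, mul_one, add_comm]
    exact hΔ.dist_triangle.trans (add_le_add (h _ _ hadj) ih)

/-- Maps of finite displacement are Lipschitz for word metrics. -/
theorem HasFiniteDisplacement.exists_dist_le {G H : Type*} [Group G] [Group H] {f : G → H}
    (hf : HasFiniteDisplacement f) {S : Set G} {T : Set H} (hS : Subgroup.closure S = ⊤)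
    (hT : Subgroup.closure T = ⊤) (hfin : S.Finite) :
    ∃ C : ℕ, ∀ x y, (SimpleGraph.mulCayley T).dist (f x) (f y) ≤
      C * (SimpleGraph.mulCayley S).dist x y := by
  obtain ⟨C, hC⟩ := ((hfin.biUnion fun s _ => hf s).image
    fun t => (SimpleGraph.mulCayley T).dist 1 t).bddAbove
  have key : ∀ x, ∀ s ∈ S, (SimpleGraph.mulCayley T).dist (f x) (f (x * s)) ≤ C := by
    intro x s hs
    have h := dist_mulCayley_mul_left_le hT (f x) 1 ((f x)⁻¹ * f (x * s))
    rw [mul_one, mul_inv_cancel_left] at h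
    exact h.trans (hC ⟨_, Set.mem_biUnion hs ⟨x, rfl⟩, rfl⟩)
  refine ⟨C, dist_le_mul_dist (mulCayley_connected hS) (mulCayley_connected hT) f C ?_⟩
  intro x y hxy
  obtain ⟨-, s, hs, rfl | rfl⟩ := (SimpleGraph.mulCayley_adj' S _ _).1 hxy
  · exact key x s hs
  · rw [SimpleGraph.dist_comm]
    exact key y s hs

/-- A bijection which has finite displacement in both directions is a quasi-isometry. -/
theorem quasiIsometricGroups_of_equiv {G H : Type*} [Group G] [Group H] [Group.FG G] (e : G ≃ H)
    (he : HasFiniteDisplacement e) (he' : HasFiniteDisplacement e.symm) :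
    QuasiIsometricGroups G H := by
  obtain ⟨S, hS, hSfin⟩ := Group.fg_iff.1 (inferInstance : Group.FG G)
  obtain ⟨T, hT, hTfin⟩ := Group.fg_iff.1 (he.fg e.surjective)
  obtain ⟨C, hC⟩ := he.exists_dist_le hS hT hSfin
  obtain ⟨D, hD⟩ := he'.exists_dist_le hT hS hTfin
  refine ⟨S, T, hS, hT, hSfin, hTfin, e, ?_⟩
  let := wordMetric S hS
  let := wordMetric T hT
  have hC' : ∀ x y, dist (e x) (e y) ≤ C * dist x y := fun x y => by
    change ((SimpleGraph.mulCayley T).dist _ _ : ℝ) ≤ C * ((SimpleGraph.mulCayley S).dist _ _ : ℝ)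
    exact_mod_cast hC x y
  have hD' : ∀ x y, dist x y ≤ D * dist (e x) (e y) := fun x y => by
    have h := hD (e x) (e y)
    rw [e.symm_apply_apply, e.symm_apply_apply] at h
    change ((SimpleGraph.mulCayley S).dist _ _ : ℝ) ≤ D * ((SimpleGraph.mulCayley T).dist _ _ : ℝ)
    exact_mod_cast h
  -- One constant has to dominate both `C` and `D` and be at least 1, even when both vanish.
  have hpos : (0 : ℝ) < C + D + 1 := by positivity
  refine ⟨⟨C + D + 1, 0, by linarith [C.cast_nonneg (α := ℝ), D.cast_nonneg (α := ℝ)], le_rfl,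
    fun x y => ⟨?_, ?_⟩⟩, 0, le_rfl, fun y => ⟨e.symm y, by simp⟩⟩
  · rw [sub_zero, one_div, inv_mul_le_iff₀ hpos]
    refine (hD' x y).trans (mul_le_mul_of_nonneg_right ?_ dist_nonneg)
    linarith [C.cast_nonneg (α := ℝ)]
  · rw [add_zero]
    refine (hC' x y).trans (mul_le_mul_of_nonneg_right ?_ dist_nonneg)
    linarith [D.cast_nonneg (α := ℝ)]

/-! ### Countability -/

theorem countable_of_fg (G : Type*) [Group G] [Group.FG G] : Countable G := by
  obtain ⟨S, hS, φ, hφ⟩ := Group.fg_iff_exists_freeGroup_hom_surjective.1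
    (inferInstance : Group.FG G)
  have := hS.to_subtype
  have : Countable (FreeGroup S) := Quot.mk_surjective.countable
  exact hφ.countable

theorem countable_monoidHom (G H : Type*) [Group G] [Group.FG G] [Group H] [Countable H] :
    Countable (G →* H) := by
  obtain ⟨S, hS, hfin⟩ := Group.fg_iff.1 (inferInstance : Group.FG G)
  have := hfin.to_subtype
  refine Function.Injective.countable (f := fun (φ : G →* H) (s : S) => φ s) fun φ ψ h => ?_
  exact MonoidHom.eq_of_eqOn_dense hS fun s hs => congrFun h ⟨s, hs⟩

/-- An equivalence relation with countable classes on an uncountable type has an uncountable set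
of pairwise inequivalent elements. -/
theorem exists_not_countable_pairwise_not_rel {α : Type*} [Uncountable α] (r : Setoid α)
    (h : ∀ a, {b | r b a}.Countable) :
    ∃ T : Set α, ¬ T.Countable ∧ T.Pairwise fun a b => ¬ r a b := by
  -- One representative per class; were there countably many, `α` would be a countable union of
  -- countable classes.
  refine ⟨Set.range (Quotient.out : Quotient r → α), fun hT => ?_, ?_⟩
  · refine Set.not_countable_univ (α := α) ((hT.biUnion fun a _ => h a).mono fun b _ => ?_)
    exact Set.mem_biUnion ⟨⟦b⟧, rfl⟩ (r.symm (Quotient.mk_out b))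
  · rintro _ ⟨p, rfl⟩ _ ⟨q, rfl⟩ hne hr
    refine hne (congrArg _ ?_)
    rw [← p.out_eq, ← q.out_eq]
    exact Quotient.sound hr

/-! ### The central extension given by a cocycle -/

variable {G : Type} [Group G]

theorem cocycle_apply (f : groupCohomology.cocycles₂ (trivialZ G)) (g h j : G) :
    (f (g * h, j) + f (g, h) : ℤ) = f (h, j) + f (g, h * j) :=
  (groupCohomology.mem_cocycles₂_iff f.1).1 f.2 g h j

/-- Cocycles are not assumed normalised; the constant `f (1, 1)` is the correction in the identity,
the inverse and the inclusion of `ℤ` below. -/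
theorem cocycle_one_left (f : groupCohomology.cocycles₂ (trivialZ G)) (g : G) :
    (f (1, g) : ℤ) = f (1, 1) := by
  have h := cocycle_apply f 1 1 g
  simp only [one_mul] at h
  linarith

theorem cocycle_one_right (f : groupCohomology.cocycles₂ (trivialZ G)) (g : G) :
    (f (g, 1) : ℤ) = f (1, 1) := by
  have h := cocycle_apply f g 1 1
  simp only [mul_one] at h
  linarith

/-- The group `ℤ × G` with the multiplication twisted by a cocycle. -/
@[ext]
structure TwistedProduct (f : groupCohomology.cocycles₂ (trivialZ G)) : Type where
  fiber : ℤ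
  base : G

namespace TwistedProduct

variable (f : groupCohomology.cocycles₂ (trivialZ G))

noncomputable instance : Mul (TwistedProduct f) :=
  ⟨fun x y => ⟨x.fiber + y.fiber + f (x.base, y.base), x.base * y.base⟩⟩

noncomputable instance : One (TwistedProduct f) := ⟨⟨-(f (1, 1) : ℤ), 1⟩⟩

noncomputable instance : Inv (TwistedProduct f) :=
  ⟨fun x => ⟨-x.fiber - (f (x.base⁻¹, x.base) : ℤ) - (f (1, 1) : ℤ), x.base⁻¹⟩⟩

@[simp] theorem fiber_mul (x y : TwistedProduct f) :
    (x * y).fiber = x.fiber + y.fiber + (f (x.base, y.base) : ℤ) := rfl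

@[simp] theorem base_mul (x y : TwistedProduct f) : (x * y).base = x.base * y.base := rfl

@[simp] theorem fiber_one : (1 : TwistedProduct f).fiber = -(f (1, 1) : ℤ) := rfl

@[simp] theorem base_one : (1 : TwistedProduct f).base = 1 := rfl

@[simp] theorem fiber_inv (x : TwistedProduct f) :
    x⁻¹.fiber = -x.fiber - (f (x.base⁻¹, x.base) : ℤ) - (f (1, 1) : ℤ) := rfl

@[simp] theorem base_inv (x : TwistedProduct f) : x⁻¹.base = x.base⁻¹ := rfl

noncomputable instance : Group (TwistedProduct f) :=
  Group.ofLeftAxioms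
    (fun x y z => by
      refine TwistedProduct.ext ?_ (mul_assoc _ _ _)
      simp only [fiber_mul, base_mul]
      linarith [cocycle_apply f x.base y.base z.base])
    (fun x => by
      refine TwistedProduct.ext ?_ (one_mul _)
      simp only [fiber_mul, fiber_one, base_one]
      linarith [cocycle_one_left f x.base])
    (fun x => by
      refine TwistedProduct.ext ?_ (inv_mul_cancel _)
      simp only [fiber_mul, fiber_inv, base_inv, fiber_one]
      ring)

/-- The extension `1 → ℤ → TwistedProduct f → G → 1`. -/
noncomputable def extension : GroupExtension (Multiplicative ℤ) (TwistedProduct f) G where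
  inl := MonoidHom.mk' (fun n => ⟨n.toAdd - (f (1, 1) : ℤ), 1⟩) fun m n =>
    TwistedProduct.ext
      (by simp only [fiber_mul, toAdd_mul]; ring)
      (one_mul _).symm
  rightHom := MonoidHom.mk' base (base_mul f)
  inl_injective := fun m n h => by
    have h' := congrArg fiber h
    exact Multiplicative.toAdd.injective (sub_left_injective h')
  range_inl_eq_ker_rightHom := by
    ext x
    constructor
    · rintro ⟨n, rfl⟩
      rfl
    · intro hx
      exact ⟨Multiplicative.ofAdd (x.fiber + (f (1, 1) : ℤ)),
        TwistedProduct.ext (add_sub_cancel_right _ _) (MonoidHom.mem_ker.1 hx).symm⟩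
  rightHom_surjective := fun g => ⟨⟨0, g⟩, rfl⟩

theorem isCentralExtensionOfClass_extension :
    IsCentralExtensionOfClass (extension f) (cocycleClass G f) where
  central := by
    rintro _ ⟨n, rfl⟩
    refine Subgroup.mem_center_iff.2 fun x => TwistedProduct.ext ?_ ?_
    · change x.fiber + (n.toAdd - (f (1, 1) : ℤ)) + (f (x.base, 1) : ℤ) =
        n.toAdd - (f (1, 1) : ℤ) + x.fiber + (f (1, x.base) : ℤ)
      linarith [cocycle_one_left f x.base, cocycle_one_right f x.base]
    · exact (mul_one x.base).trans (one_mul x.base).symm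
  class_eq := by
    refine ⟨⟨fun g => ⟨0, g⟩, fun _ => rfl⟩, f, fun g h => TwistedProduct.ext ?_ ?_, rfl⟩
    · change (0 : ℤ) + 0 + (f (g, h) : ℤ) =
        (f (g, h) : ℤ) - (f (1, 1) : ℤ) + 0 + (f (1, g * h) : ℤ)
      linarith [cocycle_one_left f (g * h)]
    · exact (one_mul (g * h)).symm

end TwistedProduct

/-! ### Central extensions up to equivalence -/

variable {E : Type*} [Group E] {X : GroupExtension (Multiplicative ℤ) E G}

theorem exists_eq_inl_mul (X : GroupExtension (Multiplicative ℤ) E G) {x y : E}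
    (h : X.rightHom x = X.rightHom y) : ∃ n, x = X.inl n * y := by
  have : x * y⁻¹ ∈ X.inl.range := by
    rw [X.range_inl_eq_ker_rightHom, MonoidHom.mem_ker, map_mul, map_inv, h, mul_inv_cancel]
  obtain ⟨n, hn⟩ := this
  exact ⟨n, by rw [hn, inv_mul_cancel_right]⟩

theorem inl_mul_comm (hX : X.inl.range ≤ Subgroup.center E) (n : Multiplicative ℤ) (x : E) :
    x * X.inl n = X.inl n * x :=
  Subgroup.mem_center_iff.1 (hX ⟨n, rfl⟩) x

theorem inl_mul_mul_inl_mul (hX : X.inl.range ≤ Subgroup.center E) (m n : Multiplicative ℤ)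
    (x y : E) : X.inl m * x * (X.inl n * y) = X.inl (m * n) * (x * y) := by
  rw [map_mul, mul_assoc, ← mul_assoc x, inl_mul_comm hX]
  simp only [mul_assoc]

/-- Equivalent central extensions correspond to the same class. -/
theorem IsCentralExtensionOfClass.eq_of_equiv {E' : Type*} [Group E']
    {X' : GroupExtension (Multiplicative ℤ) E' G} {a b : Cohomology2 G}
    (ha : IsCentralExtensionOfClass X a) (hb : IsCentralExtensionOfClass X' b)
    (e : X.Equiv X') : a = b := by
  obtain ⟨σ, f, hf, rfl⟩ := ha.class_eq
  obtain ⟨τ, f', hf', rfl⟩ := hb.class_eq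
  -- `u` compares the two sections. Expanding `e (σ g * σ h)` in two ways shows that its coboundary
  -- is `f - f'`.
  have hu : ∀ g, ∃ n : ℤ, e (σ g) = X'.inl (Multiplicative.ofAdd n) * τ g := fun g => by
    obtain ⟨n, hn⟩ := exists_eq_inl_mul X' (x := e (σ g)) (y := τ g) (by simp)
    exact ⟨n.toAdd, hn⟩
  choose u hu using hu
  refine (groupCohomology.H2π_eq_iff f f').2 ⟨u, funext fun ⟨g, h⟩ => ?_⟩
  change (u h - u (g * h) + u g : ℤ) = (f (g, h) : ℤ) - (f' (g, h) : ℤ)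
  have h1 : e (σ g * σ h) = X'.inl (Multiplicative.ofAdd (u g + u h + (f' (g, h) : ℤ))) *
      τ (g * h) := by
    rw [map_mul, hu, hu, inl_mul_mul_inl_mul hb.central, hf', ← mul_assoc, ← map_mul]
    rfl
  have h2 : e (σ g * σ h) = X'.inl (Multiplicative.ofAdd ((f (g, h) : ℤ) + u (g * h))) *
      τ (g * h) := by
    rw [hf, map_mul, hu, GroupExtension.Equiv.map_inl, ← mul_assoc, ← map_mul]
    rfl
  have h3 := Multiplicative.ofAdd.injective (X'.inl_injective (mul_right_cancel (h1.symm.trans h2)))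
  linarith

/-- Only countably many classes have a corresponding central extension by a group isomorphic to a
given finitely generated group. -/
theorem countable_of_mulEquiv [Countable G] [Group.FG E] {ι : Type*} (c : ι → Cohomology2 G)
    (hc : Function.Injective c) {F : ι → Type*} [∀ i, Group (F i)]
    (X : ∀ i, GroupExtension (Multiplicative ℤ) (F i) G)
    (hX : ∀ i, IsCentralExtensionOfClass (X i) (c i)) (e : ∀ i, F i ≃* E) : Countable ι := by
  have := countable_of_fg E
  have := countable_monoidHom E G
  -- If two indices give the same pair, composing their isomorphisms with `E` yields an equivalence
  -- of extensions.
  refine Function.Injective.countable (f := fun i =>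
    (e i ((X i).inl (Multiplicative.ofAdd 1)), (X i).rightHom.comp (e i).symm.toMonoidHom))
    fun i j hij => hc ?_
  obtain ⟨h1, h2⟩ := Prod.mk.inj hij
  refine (hX i).eq_of_equiv (hX j)
    { (e i).trans (e j).symm with
      inl_comm := ?_
      rightHom_comm := ?_ }
  · have : ((e i).trans (e j).symm).toMonoidHom.comp (X i).inl = (X j).inl :=
      MonoidHom.ext_mint ((MulEquiv.symm_apply_eq (e j)).2 h1)
    exact congrArg DFunLike.coe this
  · funext x
    have := DFunLike.congr_fun h2 (e i x)
    simpa using this.symm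

/-! ### Weakly bounded classes -/

/-- Vanishing in `ℓ^∞`-cohomology at the level of cochains, with the coboundary written out at each
point `x`. -/
theorem IsWeaklyBounded.exists_cobounding {f : groupCohomology.cocycles₂ (trivialZ G)}
    (hf : IsWeaklyBounded (cocycleClass G f)) :
    ∃ φ : G → boundedFunctions G, ∀ g h x : G,
      (f (g, h) : ℤ) = (φ h).1 (g⁻¹ * x) - (φ (g * h)).1 x + (φ g).1 x := by
  have h0 := congrArg (fun ψ => ψ.hom f) (groupCohomology.H2π_comp_map (A := trivialZ G)
    (B := ellInfty G) (MonoidHom.id G) (constants G))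
  simp only [ModuleCat.hom_comp, LinearMap.comp_apply] at h0
  unfold IsWeaklyBounded toEllInftyCohomology at hf
  rw [cocycleClass, h0] at hf
  obtain ⟨φ, hφ⟩ := (groupCohomology.H2π_eq_zero_iff _).1 hf
  refine ⟨φ, fun g h x => ?_⟩
  have h1 := congrFun hφ (g, h)
  exact (congrArg (fun F : boundedFunctions G => F.1 x) h1).symm

/-- A central extension corresponding to a weakly bounded class has a section whose cocycle is
bounded when the second argument is fixed. -/
theorem IsCentralExtensionOfClass.exists_section_bounded {a : Cohomology2 G}
    (hX : IsCentralExtensionOfClass X a) (ha : IsWeaklyBounded a) :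
    ∃ (σ : X.Section) (f : G → G → ℤ),
      (∀ g h, σ g * σ h = X.inl (Multiplicative.ofAdd (f g h)) * σ (g * h)) ∧
        ∀ h, ∃ C, ∀ g, |f g h| ≤ C := by
  obtain ⟨σ, f, hf, rfl⟩ := hX.class_eq
  obtain ⟨φ, hφ⟩ := ha.exists_cobounding
  -- The correction `-(φ g).1 1` cancels the last two terms of the coboundary formula at `x = 1`;
  -- only `φ h`, bounded for fixed `h`, is left.
  refine ⟨⟨fun g => X.inl (Multiplicative.ofAdd (-(φ g).1 1)) * σ g, fun g => by simp⟩,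
    fun g h => (φ h).1 g⁻¹ - (φ h).1 1, fun g h => ?_, fun h => ?_⟩
  · change X.inl _ * σ g * (X.inl _ * σ h) = X.inl _ * (X.inl _ * σ (g * h))
    rw [inl_mul_mul_inl_mul hX.central, hf, ← mul_assoc, ← mul_assoc]
    refine congrArg (· * σ (g * h)) ((map_mul X.inl _ _).symm.trans
      ((congrArg X.inl (Multiplicative.toAdd.injective ?_)).trans (map_mul X.inl _ _)))
    have := hφ g h 1
    simp only [mul_one] at this
    change -(φ g).1 1 + -(φ h).1 1 + (f (g, h) : ℤ) =
      (φ h).1 g⁻¹ - (φ h).1 1 + -(φ (g * h)).1 1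
    linarith
  · obtain ⟨C, hC⟩ := (φ h).2
    exact ⟨C + C, fun g => (abs_sub _ _).trans (add_le_add (hC _) (hC _))⟩

/-- A central extension corresponding to a weakly bounded class is, up to maps of finite
displacement, the product. -/
theorem IsCentralExtensionOfClass.exists_equiv_prod {a : Cohomology2 G}
    (hX : IsCentralExtensionOfClass X a) (ha : IsWeaklyBounded a) :
    ∃ e : G × Multiplicative ℤ ≃ E, HasFiniteDisplacement e ∧ HasFiniteDisplacement e.symm := by
  obtain ⟨σ, f, hf, hbdd⟩ := hX.exists_section_bounded ha
  let Ψ : G × Multiplicative ℤ → E := fun x => X.inl x.2 * σ x.1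
  have hΨ : Function.Bijective Ψ := by
    constructor
    · rintro ⟨g, m⟩ ⟨h, n⟩ hxy
      have hgh : g = h := by simpa [Ψ] using congrArg X.rightHom hxy
      subst hgh
      exact congrArg (Prod.mk g) (X.inl_injective (mul_right_cancel hxy))
    · intro y
      obtain ⟨n, hn⟩ := exists_eq_inl_mul X (x := y) (y := σ (X.rightHom y)) (by simp)
      exact ⟨(X.rightHom y, n), hn.symm⟩
  have hmul : ∀ x y, Ψ x * Ψ y = X.inl (Multiplicative.ofAdd (f x.1 y.1)) * Ψ (x * y) := by
    intro x y
    simp only [Ψ, Prod.fst_mul, Prod.snd_mul]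
    rw [inl_mul_mul_inl_mul hX.central, hf, ← mul_assoc, ← mul_assoc, ← map_mul, ← map_mul,
      mul_comm]
  have hrange : ∀ h, (Set.range fun g => f g h).Finite := fun h => by
    obtain ⟨C, hC⟩ := hbdd h
    refine (Set.finite_Icc (-C) C).subset ?_
    rintro _ ⟨g, rfl⟩
    exact abs_le.1 (hC g)
  -- By `hmul`, the displacement of `Ψ` at `x` is `Ψ s` times the inverse of the central element `f
  -- x.1 s.1`; that of the inverse is `s` times this central element. Both vary in a finite set by
  -- `hrange`.
  refine ⟨Equiv.ofBijective Ψ hΨ, fun s => ?_, fun t => ?_⟩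
  · refine ((hrange s.1).image
      fun n => (X.inl (Multiplicative.ofAdd n))⁻¹ * Ψ s).subset ?_
    rintro _ ⟨x, rfl⟩
    refine ⟨_, ⟨x.1, rfl⟩, ?_⟩
    have h := hmul x s
    simp only [Equiv.ofBijective_apply]
    rw [eq_inv_mul_iff_mul_eq, ← mul_assoc, ← map_inv, inl_mul_comm hX.central, mul_assoc, h,
      ← mul_assoc, ← map_mul, inv_mul_cancel, map_one, one_mul]
  · obtain ⟨s, rfl⟩ := hΨ.2 t
    refine ((hrange s.1).image fun n => s * (1, Multiplicative.ofAdd n)).subset ?_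
    rintro _ ⟨y, rfl⟩
    obtain ⟨x, rfl⟩ := hΨ.2 y
    refine ⟨_, ⟨x.1, rfl⟩, ?_⟩
    have hinv : ∀ x, (Equiv.ofBijective Ψ hΨ).symm (Ψ x) = x :=
      (Equiv.ofBijective Ψ hΨ).symm_apply_apply
    have h : Ψ x * Ψ s = Ψ (x * (s * (1, Multiplicative.ofAdd (f x.1 s.1)))) := by
      rw [hmul]
      simp only [Ψ, Prod.fst_mul, Prod.snd_mul, mul_one]
      rw [← mul_assoc, ← map_mul, mul_comm, mul_assoc]
    simp only [h, hinv, inv_mul_cancel_left]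

instance fg_prod_multiplicative_int [Group.FG G] : Group.FG (G × Multiplicative ℤ) := by
  have h := (Group.FG.out : (⊤ : Subgroup G).FG).prod
    (Group.FG.out : (⊤ : Subgroup (Multiplicative ℤ)).FG)
  rw [Subgroup.top_prod_top] at h
  exact ⟨h⟩

end LargeQIClass

theorem theorem1p2 (G : Type) [Group G] [Group.FG G]
    (hab : Module.Free ℤ (Additive (Abelianization G)))
    (S : Set (LargeQIClass.Cohomology2 G)) (hS : ¬ S.Countable)
    (hdist : S.Pairwise LargeQIClass.AreDistinguished)
    (hrich : ∀ a ∈ S, LargeQIClass.IsRich a)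
    (hwb : ∀ a ∈ S, LargeQIClass.IsWeaklyBounded a) :
    -- every class in `S` has a corresponding central extension
    (∀ a : S, ∃ (E : Type) (_ : Group E) (X : GroupExtension (Multiplicative ℤ) E G),
      LargeQIClass.IsCentralExtensionOfClass X (a : LargeQIClass.Cohomology2 G)) ∧
    -- and however the corresponding central extensions `E a` are chosen:
    ∀ (E : S → Type) [∀ a, Group (E a)] (X : ∀ a, GroupExtension (Multiplicative ℤ) (E a) G),
      (∀ a, LargeQIClass.IsCentralExtensionOfClass (X a) (a : LargeQIClass.Cohomology2 G)) →
      (∀ a, LargeQIClass.QuasiIsometricGroups (E a) (G × Multiplicative ℤ)) ∧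
      (∀ a b, LargeQIClass.QuasiIsometricGroups (E a) (E b)) ∧
      ∃ T : Set S, ¬ T.Countable ∧ T.Pairwise fun a b => IsEmpty (E a ≃* E b) := by

  refine ⟨fun a => ?_, fun E _ X hX => ?_⟩
  · obtain ⟨f, hf⟩ := LargeQIClass.cocycleClass_surjective G a
    exact ⟨_, _, _, hf ▸ LargeQIClass.TwistedProduct.isCentralExtensionOfClass_extension f⟩
  choose e he he' using fun a => (hX a).exists_equiv_prod (hwb a a.2)
  have hfg : ∀ a, Group.FG (E a) := fun a => (he a).fg (e a).surjective
  refine ⟨fun a => LargeQIClass.quasiIsometricGroups_of_equiv (e a).symm (he' a) (he a),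
    fun a b => LargeQIClass.quasiIsometricGroups_of_equiv ((e a).symm.trans (e b))
      ((he b).comp (he' a)) ((he a).comp (he' b)), ?_⟩
  have : Countable G := LargeQIClass.countable_of_fg G
  have : Uncountable S := not_countable_iff.1 hS
  let r : Setoid S :=
    { r := fun a b => Nonempty (E a ≃* E b)
      iseqv := ⟨fun a => ⟨MulEquiv.refl _⟩, fun ⟨φ⟩ => ⟨φ.symm⟩,
        fun ⟨φ⟩ ⟨ψ⟩ => ⟨φ.trans ψ⟩⟩ }
  obtain ⟨T, hT, hpair⟩ := LargeQIClass.exists_not_countable_pairwise_not_rel r fun a =>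
    LargeQIClass.countable_of_mulEquiv (ι := {b | r b a}) (fun b => (b.1 : LargeQIClass.Cohomology2 G))
      (Subtype.val_injective.comp Subtype.val_injective) (fun b => X b.1) (fun b => hX b.1)
      fun b => b.2.some
  exact ⟨T, hT, hpair.imp fun a b h => not_nonempty_iff.1 h⟩
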